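/- Let $n\ge 1$ be an integer. For a metric space $X$ let $\dim_H X$ denote its Hausdorff dimension and $\dim_t X$ its (small inductive) topological dimension, with the conventions $\dim_H\emptyset=\dim_t\emptyset=-1$. The inductive topological Hausdorff dimensions are defined by $\dim_{t^kH}\emptyset=-1$ for all integers $k\ge 0$ and, for non-empty $X$, by $\dim_{t^0H}X=\dim_H X$ and, for $k\ge 1$, $$\dim_{t^kH}X=\inf\{d : X \text{ has a basis } \mathcal U \text{ of open sets such that } \dim_{t^{k-1}H}\partial U\le d-1 \text{ for every } U\in\mathcal U\},$$ where $d=\infty$ is allowed and $\infty-1=\infty$. For a compact metric space $K$ let $C_n(K)$ be the space of continuous maps $K\to\mathbb R^n$ with the supremum norm. If $K$ is a compact metric space with $\dim_t K\ge n$, then for the generic $f\in C_n(K)$, that is, for all $f$ in a co-meager subset of $C_n(K)$, $$\sup_{y\in\mathbb R^n}\dim_H f^{-1}(y)=\dim_{t^nH}K-n,$$ where $\infty-n=\infty$. -/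

import Mathlib

open Topology TopologicalSpace

noncomputable section

universe u

open Classical in
/-- The Hausdorff dimension of a subset of a metric space, as an extended real number,
with the convention that the empty set has Hausdorff dimension `-1`. -/
def hausdorffDim {X : Type u} [MetricSpace X] (s : Set X) : EReal :=
  if s = ∅ then -1 else (dimH s : EReal)

open Classical in
/-- The `n`th inductive topological Hausdorff dimension of a metric space. The empty space has
dimension `-1`; for a non-empty space the `0`th dimension is the Hausdorff dimension, and the
`(n+1)`st one is the infimum of all `d` such that `X` has a basis of open sets whose boundaries
(as metric subspaces) have `n`th dimension at most `d - 1`. Here `⊤ - 1 = ⊤`. -/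
def indTopHausdorffDim : ℕ → (X : Type u) → [MetricSpace X] → EReal
  | 0, X, _ => hausdorffDim (Set.univ : Set X)
  | n + 1, X, _ =>
    if IsEmpty X then -1
    else sInf {d : EReal | ∃ B : Set (Set X), IsTopologicalBasis B ∧
      ∀ U ∈ B, indTopHausdorffDim n (frontier U) ≤ d - 1}

end

open MeasureTheory Set Filter Metric
open scoped ENNReal NNReal

/-! For each rational `q > 0`, compare $\dim_{t^nH}K$ with $q+n$. Hausdorff measure is replaced by
Hausdorff content, for which compactness makes "all fibers null" a $G_\delta$ condition on $f$. A
map to $\mathbb R^n$ is treated as an $n$-tuple of real functions, and both bounds go by induction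
on $n$, peeling off the first coordinate.

Upper bound (`eventually_residual_hausdorffContent_eq_zero`): cover the compact set by finitely many
small basic sets with low-dimensional frontiers. By induction, generic remaining coordinates have
null fibers on these frontiers, hence small content near them. Away from the frontiers the cover is
clopen, so a small change of the first coordinate puts each level set inside one small set.

Lower bound (`indTopHausdorffDim_le_of_eventually_residual`): suppose null fibers are generic in
some open set of tuples. By Kuratowski–Ulam, a dense set of first coordinates `b` admits generic
companions with null fibers. Level sets of such `b` contain the frontiers of a basis, and induction
bounds the dimension of these frontiers. A $G_\delta$ set residual in no non-empty open set is
meager, so a large dimension makes a large fiber generic. -/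

/-- The `q`-dimensional Hausdorff content, as an outer measure. -/
noncomputable def hausdorffContent {X : Type*} [MetricSpace X] (q : ℝ≥0) : OuterMeasure X :=
  OuterMeasure.boundedBy fun s => ediam s ^ (q : ℝ)

/-! ### Hausdorff content and its relation to Hausdorff dimension. -/

section HausdorffContent

variable {X : Type*} [MetricSpace X] {q : ℝ≥0} {s : Set X}

theorem hausdorffContent_le_ediam (q : ℝ≥0) (s : Set X) :
    hausdorffContent q s ≤ ediam s ^ (q : ℝ) :=
  OuterMeasure.boundedBy_le _

theorem exists_cover_of_hausdorffContent_lt (hq : 0 < q) {η : ℝ≥0∞}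
    (h : hausdorffContent q s < η) :
    ∃ t : ℕ → Set X, s ⊆ ⋃ n, t n ∧ ∑' n, ediam (t n) ^ (q : ℝ) < η := by
  have h0 : ediam (∅ : Set X) ^ (q : ℝ) = 0 := by
    rw [ediam_empty, ENNReal.zero_rpow_of_pos (by exact_mod_cast hq)]
  rw [hausdorffContent, OuterMeasure.boundedBy_eq_ofFunction h0, OuterMeasure.ofFunction_apply] at h
  simpa [iInf_lt_iff] using h

/-- Thickening the `n`-th set of a cover raises its cost by at most `ε n`, and the `ε n` sum to less
than the slack. -/
theorem exists_isOpen_hausdorffContent_lt (hq : 0 < q) {η : ℝ≥0∞}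
    (h : hausdorffContent q s < η) :
    ∃ U : Set X, IsOpen U ∧ s ⊆ U ∧ hausdorffContent q U < η := by
  obtain ⟨t, hst, ht⟩ := exists_cover_of_hausdorffContent_lt hq h
  obtain ⟨ε, hε, hε'⟩ := ENNReal.exists_pos_sum_of_countable (tsub_pos_of_lt ht).ne' ℕ
  have hfin (n : ℕ) : ediam (t n) ^ (q : ℝ) ≠ ⊤ :=
    ((ENNReal.le_tsum n).trans_lt (ht.trans_le le_top)).ne
  have key (n : ℕ) : ∃ δ > 0, ediam (thickening δ (t n)) ^ (q : ℝ)
      ≤ ediam (t n) ^ (q : ℝ) + ε n := by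
    have hc : Tendsto (fun x : ℝ≥0 => (ediam (t n) + 2 * (x : ℝ≥0∞)) ^ (q : ℝ)) (𝓝[>] 0)
        (𝓝 (ediam (t n) ^ (q : ℝ))) := by
      have : Continuous (fun x : ℝ≥0 => (ediam (t n) + 2 * (x : ℝ≥0∞)) ^ (q : ℝ)) := by
        have h2 : Continuous fun x : ℝ≥0 => 2 * (x : ℝ≥0∞) :=
          (ENNReal.continuous_const_mul (by simp)).comp ENNReal.continuous_coe
        exact ENNReal.continuous_rpow_const.comp (continuous_const.add h2)
      simpa using (this.tendsto 0).mono_left nhdsWithin_le_nhds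
    have hlt : ediam (t n) ^ (q : ℝ) < ediam (t n) ^ (q : ℝ) + ε n :=
      ENNReal.lt_add_right (hfin n) (by exact_mod_cast (hε n).ne')
    obtain ⟨δ, h1, h2⟩ := ((hc.eventually (gt_mem_nhds hlt)).and self_mem_nhdsWithin).exists
    refine ⟨δ, by exact_mod_cast h2, le_trans ?_ h1.le⟩
    gcongr
    exact ediam_thickening_le δ
  choose δ hδ hδ' using key
  refine ⟨⋃ n, thickening (δ n) (t n), isOpen_iUnion fun n => isOpen_thickening,
    hst.trans (iUnion_mono fun n => self_subset_thickening (hδ n) _), ?_⟩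
  calc hausdorffContent q (⋃ n, thickening (δ n) (t n))
      ≤ ∑' n, hausdorffContent q (thickening (δ n) (t n)) := measure_iUnion_le _
    _ ≤ ∑' n, (ediam (t n) ^ (q : ℝ) + ε n) :=
        ENNReal.tsum_le_tsum fun n => (hausdorffContent_le_ediam _ _).trans (hδ' n)
    _ = ∑' n, ediam (t n) ^ (q : ℝ) + ∑' n, (ε n : ℝ≥0∞) := ENNReal.tsum_add
    _ < ∑' n, ediam (t n) ^ (q : ℝ) + (η - ∑' n, ediam (t n) ^ (q : ℝ)) :=
        ENNReal.add_lt_add_left (ht.trans_le le_top).ne hε'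
    _ = η := add_tsub_cancel_of_le ht.le

theorem hausdorffContent_eq_zero_of_dimH_lt (h : dimH s < q) : hausdorffContent q s = 0 := by
  borelize X
  have hm := hausdorffMeasure_of_dimH_lt h
  refine le_antisymm (le_trans ?_ hm.le) zero_le
  rw [Measure.hausdorffMeasure_apply]
  refine le_iSup₂_of_le 1 one_pos (le_iInf₂ fun t ht => le_iInf fun _ => ?_)
  calc hausdorffContent q s ≤ hausdorffContent q (⋃ n, t n) := measure_mono ht
    _ ≤ ∑' n, hausdorffContent q (t n) := measure_iUnion_le _
    _ ≤ _ := ENNReal.tsum_le_tsum fun n => ?_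
  rcases (t n).eq_empty_or_nonempty with h | h
  · simp [h]
  · simpa [h] using hausdorffContent_le_ediam q (t n)

/-- A cover of small total cost has small mesh automatically, each diameter being at most the `q`-th
root of the cost; so null content forces null Hausdorff measure. -/
theorem dimH_le_of_hausdorffContent_eq_zero (hq : 0 < q) (h : hausdorffContent q s = 0) :
    dimH s ≤ q := by
  borelize X
  have hq' : (0 : ℝ) < q := by exact_mod_cast hq
  have hcov (n : ℕ) : ∃ t : ℕ → Set X, s ⊆ ⋃ k, t k ∧
      ∑' k, ediam (t k) ^ (q : ℝ) < ((n : ℝ≥0∞) + 1)⁻¹ :=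
    exists_cover_of_hausdorffContent_lt hq (by rw [h]; simp)
  choose t hst ht using hcov
  have h0 : Tendsto (fun n : ℕ => ((n : ℝ≥0∞) + 1)⁻¹) atTop (𝓝 0) := by
    have := (tendsto_add_atTop_iff_nat 1).2 ENNReal.tendsto_inv_nat_nhds_zero
    simpa using this
  have hr : Tendsto (fun n : ℕ => (((n : ℝ≥0∞) + 1)⁻¹) ^ (q : ℝ)⁻¹) atTop (𝓝 0) := by
    have := (ENNReal.continuous_rpow_const (y := (q : ℝ)⁻¹)).tendsto 0 |>.comp h0
    rwa [ENNReal.zero_rpow_of_pos (inv_pos.2 hq')] at this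
  have hle : μH[q] s ≤ 0 := by
    refine (Measure.hausdorffMeasure_le_liminf_tsum (q : ℝ) s _ hr t
      (.of_forall fun n k => ?_) (.of_forall hst)).trans ?_
    · rw [ENNReal.le_rpow_inv_iff hq']
      exact (ENNReal.le_tsum k).trans (ht n).le
    · refine (liminf_le_liminf (.of_forall fun n => (ht n).le)).trans ?_
      rw [h0.liminf_eq]
  exact dimH_le_of_hausdorffMeasure_ne_top (by simp [nonpos_iff_eq_zero.1 hle])

end HausdorffContent

/-! ### Fibers of tuples of functions and semicontinuity of their content. -/

section CommonFiber

variable {K : Type*} [MetricSpace K] {n : ℕ}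

/-- The set of points at which the functions `f j` take the prescribed values `y j`. -/
def commonFiber (f : Fin n → C(K, ℝ)) (y : Fin n → ℝ) : Set K := {x | ∀ j, f j x = y j}

theorem mem_commonFiber {f : Fin n → C(K, ℝ)} {y : Fin n → ℝ} {x : K} :
    x ∈ commonFiber f y ↔ ∀ j, f j x = y j := Iff.rfl

theorem commonFiber_cons (a : C(K, ℝ)) (f : Fin n → C(K, ℝ)) (y : Fin (n + 1) → ℝ) :
    commonFiber (Fin.cons a f : Fin (n + 1) → C(K, ℝ)) y
      = {x | a x = y 0} ∩ commonFiber f (Fin.tail y) := by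
  ext x
  simp [mem_commonFiber, Fin.forall_fin_succ, Fin.tail]

variable {q : ℝ≥0} {F : Set K}

/-- Exhibits nullity of all fibers as a countable conjunction of conditions, each open for closed
`F` in compact `K` when `q > 0`. -/
theorem forall_hausdorffContent_eq_zero_iff {f : Fin n → C(K, ℝ)} :
    (∀ y, hausdorffContent q (commonFiber f y ∩ F) = 0) ↔
      ∀ m : ℕ, ∀ y, hausdorffContent q (commonFiber f y ∩ F) < ((m : ℝ≥0∞) + 1)⁻¹ := by
  refine ⟨fun h m y => by rw [h]; simp, fun h y => ?_⟩
  by_contra hne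
  obtain ⟨m, hm⟩ := ENNReal.exists_inv_nat_lt hne
  exact ((h m y).trans_le (ENNReal.inv_le_inv.2 le_self_add)).not_gt hm

variable [CompactSpace K] {η : ℝ≥0∞}

/-- If all the fibers over a closed set have small content, this is still true, uniformly, for
slightly thickened fibers over a slightly thickened set. -/
theorem exists_pos_forall_hausdorffContent_thickened_lt (hq : 0 < q) (hF : IsClosed F)
    {f : Fin n → C(K, ℝ)} (h : ∀ y, hausdorffContent q (commonFiber f y ∩ F) < η) :
    ∃ r > 0, ∀ y : Fin n → ℝ,
      hausdorffContent q {x ∈ thickening r F | ∀ j, |f j x - y j| < r} < η := by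
  by_contra! H
  have hr (k : ℕ) : (0 : ℝ) < 1 / ((k : ℝ) + 1) := by positivity
  choose y hy using fun k : ℕ => H _ (hr k)
  have hη : 0 < η := zero_le.trans_lt (h 0)
  have hne (k : ℕ) :
      {x ∈ thickening (1 / ((k : ℝ) + 1)) F | ∀ j, |f j x - y k j| < 1 / ((k : ℝ) + 1)}.Nonempty := by
    rw [nonempty_iff_ne_empty]
    intro he
    have := hy k
    rw [he, measure_empty] at this
    exact this.not_gt hη
  choose x hx using hne
  obtain ⟨x₀, φ, hφ, hxφ⟩ := CompactSpace.tendsto_subseq x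
  -- `A` surrounds the fiber through the limit `x₀`. Each bad thickened fiber leaves `A` at some `z
  -- k`, yet a limit of these points lies in that same fiber and in `F`.
  obtain ⟨A, hA, hsub, hAη⟩ := exists_isOpen_hausdorffContent_lt hq (h fun j => f j x₀)
  have hnot (k : ℕ) : ∃ z ∈ {x ∈ thickening (1 / ((k : ℝ) + 1)) F |
      ∀ j, |f j x - y k j| < 1 / ((k : ℝ) + 1)}, z ∉ A := by
    by_contra! hz
    exact ((hy k).trans (measure_mono hz)).not_gt hAη
  choose z hz hzA using hnot
  obtain ⟨z₀, ψ, hψ, hzψ⟩ := CompactSpace.tendsto_subseq (z ∘ φ)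
  have h0 : Tendsto (fun k => 1 / (((φ (ψ k) : ℕ) : ℝ) + 1)) atTop (𝓝 0) :=
    tendsto_one_div_add_atTop_nhds_zero_nat.comp (hφ.tendsto_atTop.comp hψ.tendsto_atTop)
  have hzA₀ : z₀ ∉ A :=
    hA.isClosed_compl.mem_of_tendsto hzψ (.of_forall fun k => hzA (φ (ψ k)))
  refine hzA₀ (hsub ⟨fun j => ?_, ?_⟩)
  · have h1 : Tendsto (fun k => f j (z (φ (ψ k))) - f j (x (φ (ψ k)))) atTop
        (𝓝 (f j z₀ - f j x₀)) :=
      (((f j).continuous.tendsto _).comp hzψ).sub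
        (((f j).continuous.tendsto _).comp (hxφ.comp hψ.tendsto_atTop))
    have h2 : Tendsto (fun k => f j (z (φ (ψ k))) - f j (x (φ (ψ k)))) atTop (𝓝 0) := by
      refine squeeze_zero_norm (a := fun k => 2 * (1 / (((φ (ψ k) : ℕ) : ℝ) + 1)))
        (fun k => ?_) (by simpa using h0.const_mul 2)
      have e1 := abs_lt.1 ((hz (φ (ψ k))).2 j)
      have e2 := abs_lt.1 ((hx (φ (ψ k))).2 j)
      rw [Real.norm_eq_abs, abs_le]
      constructor <;> linarith
    exact sub_eq_zero.1 (tendsto_nhds_unique h1 h2)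
  · have hzF (k : ℕ) : infEDist (z (φ (ψ k))) F ≤ ENNReal.ofReal (1 / (((φ (ψ k) : ℕ) : ℝ) + 1)) :=
      (mem_thickening_iff_infEDist_lt.1 (hz (φ (ψ k))).1).le
    have h1 : Tendsto (fun k => infEDist (z (φ (ψ k))) F) atTop (𝓝 (infEDist z₀ F)) :=
      (continuous_infEDist.tendsto _).comp hzψ
    have h2 := le_of_tendsto_of_tendsto' h1 (ENNReal.tendsto_ofReal h0) hzF
    rw [ENNReal.ofReal_zero] at h2
    rw [← hF.closure_eq, mem_closure_iff_infEDist_zero]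
    exact nonpos_iff_eq_zero.1 h2

theorem isOpen_setOf_forall_hausdorffContent_lt (hq : 0 < q) (hF : IsClosed F) :
    IsOpen {f : Fin n → C(K, ℝ) | ∀ y, hausdorffContent q (commonFiber f y ∩ F) < η} := by
  rw [Metric.isOpen_iff]
  intro f hf
  obtain ⟨r, hr, h⟩ := exists_pos_forall_hausdorffContent_thickened_lt hq hF hf
  refine ⟨r, hr, fun g hg y => lt_of_le_of_lt (measure_mono ?_) (h y)⟩
  rintro x ⟨hx, hxF⟩
  refine ⟨self_subset_thickening hr F hxF, fun j => ?_⟩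
  rw [← hx j, abs_sub_comm, ← Real.dist_eq]
  exact (ContinuousMap.dist_apply_le_dist x).trans_lt ((dist_le_pi_dist g f j).trans_lt hg)

end CommonFiber

/-! ### Baire category tools. -/

section Residual

variable {X Y : Type*} [TopologicalSpace X] [TopologicalSpace Y]

/-- **Kuratowski–Ulam**: residually many sections of a residual set are residual. -/
theorem eventually_residual_curry [SecondCountableTopology Y] {p : X × Y → Prop}
    (h : ∀ᶠ z in residual (X × Y), p z) :
    ∀ᶠ x in residual X, ∀ᶠ y in residual Y, p (x, y) := by
  obtain ⟨S, hSo, hSd, hSc, hS⟩ := mem_residual_iff.1 h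
  have key : ∀ W ∈ S, ∀ᶠ x in residual X, Dense {y | (x, y) ∈ W} := by
    intro W hW
    have : ∀ V ∈ countableBasis Y, ∀ᶠ x in residual X, ∃ y ∈ V, (x, y) ∈ W := by
      intro V hV
      have hVo := isOpen_of_mem_countableBasis hV
      have heq : {x | ∃ y ∈ V, (x, y) ∈ W} = Prod.fst '' (W ∩ univ ×ˢ V) := by
        ext x; constructor
        · rintro ⟨y, hy, hxy⟩
          exact ⟨(x, y), ⟨hxy, trivial, hy⟩, rfl⟩
        · rintro ⟨⟨x', y⟩, ⟨hxy, -, hy⟩, rfl⟩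
          exact ⟨y, hy, hxy⟩
      refine residual_of_dense_open (s := {x | ∃ y ∈ V, (x, y) ∈ W}) ?_ ?_
      · rw [heq]
        exact isOpenMap_fst _ ((hSo W hW).inter (isOpen_univ.prod hVo))
      · rw [dense_iff_inter_open]
        rintro U hU ⟨u, hu⟩
        obtain ⟨v, hv⟩ := nonempty_of_mem_countableBasis hV
        obtain ⟨⟨x, y⟩, ⟨hx, hy⟩, hxy⟩ :=
          (hSd W hW).inter_open_nonempty _ (hU.prod hVo) ⟨(u, v), hu, hv⟩
        exact ⟨x, hx, y, hy, hxy⟩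
    filter_upwards [(eventually_countable_ball (countable_countableBasis Y)).2 this] with x hx
    rw [(isBasis_countableBasis Y).dense_iff]
    intro V hV _
    obtain ⟨y, hy, hxy⟩ := hx V hV
    exact ⟨y, hy, hxy⟩
  filter_upwards [(eventually_countable_ball hSc).2 key] with x hx
  have : ∀ᶠ y in residual Y, ∀ W ∈ S, (x, y) ∈ W :=
    (eventually_countable_ball hSc).2 fun W hW =>
      residual_of_dense_open ((hSo W hW).preimage (by fun_prop)) (hx W hW)
  filter_upwards [this] with y hy using hS (mem_sInter.2 hy)

/-- A countable intersection of open sets that is not residual in any non-empty open set has a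
residual complement. -/
theorem eventually_residual_not_of_forall_isOpen {p : ℕ → X → Prop}
    (hp : ∀ m, IsOpen {x | p m x})
    (h : ∀ O : Set X, IsOpen O → O.Nonempty → ¬ ∀ᶠ x in residual X, x ∈ O → ∀ m, p m x) :
    ∀ᶠ x in residual X, ¬ ∀ m, p m x := by
  -- A generic point avoids the nowhere dense boundary of each open set, so in the closure of the
  -- intersection it satisfies every `p m`.
  have h1 : ∀ᶠ x in residual X, ∀ m, x ∈ coborder {x | p m x} :=
    eventually_countable_forall.2 fun m => coborder_mem_residual (hp m).isLocallyClosed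
  have h2 : interior (closure {x | ∀ m, p m x}) = ∅ := by
    by_contra hne
    refine h _ isOpen_interior (nonempty_iff_ne_empty.2 hne) ?_
    filter_upwards [h1] with x hx hxO m
    by_contra hnot
    have := hx m
    rw [coborder_eq_union_closure_compl] at this
    rcases this with hx' | hx'
    · exact hnot hx'
    · exact hx' (closure_mono (ofPred_subset_ofPred.2 fun z hz => hz m) (interior_subset hxO))
  refine mem_of_superset (residual_of_dense_open isClosed_closure.isOpen_compl
    (interior_eq_empty_iff_dense_compl.1 h2)) fun x hx hx' => hx (subset_closure hx')

/-- Splitting off the first coordinate is a homeomorphism. -/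
def Homeomorph.finCons (X : Type*) [TopologicalSpace X] (n : ℕ) :
    X × (Fin n → X) ≃ₜ (Fin (n + 1) → X) where
  toEquiv := Fin.consEquiv fun _ => X
  continuous_toFun := by
    refine continuous_pi fun j => ?_
    refine Fin.cases ?_ (fun j => ?_) j
    · simpa using continuous_fst
    · exact (continuous_apply j).comp continuous_snd
  continuous_invFun := by
    refine Continuous.prodMk (continuous_apply 0) (continuous_pi fun j => continuous_apply j.succ)

theorem Homeomorph.finCons_apply (x : X) {n : ℕ} (f : Fin n → X) :
    Homeomorph.finCons X n (x, f) = (Fin.cons x f : Fin (n + 1) → X) := rfl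

end Residual

/-! ### Perturbing a function to separate the members of a clopen cover. -/

section Perturbation

theorem exists_injective_forall_abs_sub_le {ι : Type*} [Finite ι] (b : ι → ℝ) {ε : ℝ}
    (hε : 0 < ε) : ∃ c : ι → ℝ, Function.Injective c ∧ ∀ j, |c j - b j| ≤ ε := by
  obtain ⟨k, ⟨e⟩⟩ := Finite.exists_equiv_fin ι
  -- These are the slopes `t` at which two of the values `b j + t * e j` could coincide.
  have hbad : (range fun p : ι × ι => (b p.1 - b p.2) / ((e p.2 : ℝ) - e p.1)).Finite :=
    finite_range _
  have hpos : 0 < ε / (k + 1) := by positivity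
  obtain ⟨t, ⟨ht0, htε⟩, ht⟩ := ((Ioo_infinite hpos).sdiff hbad).nonempty
  refine ⟨fun j => b j + t * (e j : ℝ), fun j l hjl => ?_, fun j => ?_⟩
  · by_contra hne
    have hne' : ((e l : ℝ) - e j) ≠ 0 := by
      rw [sub_ne_zero]
      intro h
      exact hne (e.injective (Fin.ext (by exact_mod_cast h.symm)))
    refine ht ⟨(j, l), ?_⟩
    simp only at hjl ⊢
    rw [div_eq_iff hne']
    linarith
  · have h1 : (e j : ℝ) ≤ k := by exact_mod_cast (e j).is_lt.le
    have h2 : (0 : ℝ) ≤ e j := by positivity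
    rw [add_sub_cancel_left, abs_of_nonneg (by positivity)]
    calc t * (e j : ℝ) ≤ ε / (k + 1) * k := by gcongr
      _ ≤ ε := by
        rw [div_mul_eq_mul_div, div_le_iff₀ (by positivity)]
        nlinarith

/-- A continuous function that varies little on each set of a finite clopen cover of a closed set
can be perturbed so that its level sets over the closed set are contained in sets of the cover. -/
theorem exists_perturbation_of_clopen_cover {K W ι : Type*} [TopologicalSpace K] [NormalSpace K]
    [TopologicalSpace W] [Finite ι] {e : W → K} (he : IsClosedEmbedding e) (a : C(K, ℝ)) {ε : ℝ}
    (hε : 0 < ε) (U : ι → Set W) (hU : ∀ j, IsClopen (U j)) (hcov : ∀ w, ∃ j, w ∈ U j)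
    (hosc : ∀ j, ∀ z ∈ U j, ∀ w ∈ U j, |a (e z) - a (e w)| ≤ ε) :
    ∃ b : C(K, ℝ), (∀ x, |b x - a x| ≤ 2 * ε) ∧
      ∀ z w, b (e z) = b (e w) → ∃ j, z ∈ U j ∧ w ∈ U j := by
  classical
  have hval (j : ι) : ∃ v : ℝ, ∀ w ∈ U j, |v - a (e w)| ≤ ε := by
    rcases (U j).eq_empty_or_nonempty with h | ⟨z, hz⟩
    · exact ⟨0, by simp [h]⟩
    · exact ⟨a (e z), hosc j z hz⟩
  choose v hv using hval
  obtain ⟨c, hc, hcv⟩ := exists_injective_forall_abs_sub_le v hε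
  -- The chosen index depends only on the set of members containing the point, so the choice is
  -- locally constant.
  have hpick (T : Set ι) : ∃ o : Option ι, ∀ w : W, T = {j | w ∈ U j} → ∃ j ∈ T, o = some j := by
    rcases T.eq_empty_or_nonempty with h | ⟨j, hj⟩
    · refine ⟨none, fun w hw => ?_⟩
      obtain ⟨j, hj⟩ := hcov w
      have : j ∈ T := hw ▸ hj
      simp [h] at this
    · exact ⟨some j, fun _ _ => ⟨j, hj, rfl⟩⟩
  choose pick hpick using hpick
  have hloc : IsLocallyConstant fun w : W => {j | w ∈ U j} := by
    rw [IsLocallyConstant.iff_eventually_eq]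
    intro w
    have : ∀ j, ∀ᶠ z in 𝓝 w, (z ∈ U j ↔ w ∈ U j) := by
      intro j
      by_cases hw : w ∈ U j
      · filter_upwards [(hU j).isOpen.mem_nhds hw] with z hz
        simp [hz, hw]
      · filter_upwards [(hU j).isClosed.isOpen_compl.mem_nhds hw] with z hz
        exact iff_of_false hz hw
    filter_upwards [eventually_all.2 this] with z hz
    ext j
    exact hz j
  let g : W → ℝ := fun w => (pick {j | w ∈ U j}).elim 0 c
  have hg : Continuous g := (hloc.comp fun T => (pick T).elim 0 c).continuous
  have hgc (w : W) : ∃ j, w ∈ U j ∧ g w = c j := by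
    obtain ⟨j, hj, hj'⟩ := hpick _ w rfl
    exact ⟨j, hj, by simp [g, hj']⟩
  let d : C(W, ℝ) := ⟨fun w => g w - a (e w), hg.sub (a.continuous.comp he.continuous)⟩
  have hd (w : W) : d w ∈ Icc (-(2 * ε)) (2 * ε) := by
    obtain ⟨j, hj, hgj⟩ := hgc w
    have h1 := abs_le.1 (hcv j)
    have h2 := abs_le.1 (hv j w hj)
    change g w - a (e w) ∈ _
    rw [hgj]
    constructor <;> linarith
  -- Tietze is applied to the correction rather than to `g`, so that the bound `2 * ε` persists on
  -- all of `K`.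
  obtain ⟨D, hD, hDd⟩ := d.exists_extension_forall_mem_of_isClosedEmbedding hd
    ⟨0, by constructor <;> linarith⟩ he
  have hDe (w : W) : a (e w) + D (e w) = g w := by
    have : D (e w) = g w - a (e w) := congrFun hDd w
    rw [this]; ring
  refine ⟨a + D, fun x => ?_, fun z w hzw => ?_⟩
  · simpa [abs_le] using hD x
  · obtain ⟨j, hj, hgj⟩ := hgc z
    obtain ⟨l, hl, hgl⟩ := hgc w
    simp only [ContinuousMap.add_apply, hDe, hgj, hgl] at hzw
    exact ⟨j, hj, hc hzw ▸ hl⟩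

end Perturbation

/-! ### Elementary properties of the dimensions. -/

theorem hausdorffDim_of_nonempty {X : Type*} [MetricSpace X] {s : Set X} (h : s.Nonempty) :
    hausdorffDim s = (dimH s : EReal) :=
  if_neg h.ne_empty

theorem hausdorffDim_empty {X : Type*} [MetricSpace X] : hausdorffDim (∅ : Set X) = -1 :=
  if_pos rfl

theorem indTopHausdorffDim_succ_of_nonempty {X : Type*} [MetricSpace X] [Nonempty X] (n : ℕ) :
    indTopHausdorffDim (n + 1) X = sInf {d : EReal | ∃ B : Set (Set X), IsTopologicalBasis B ∧
      ∀ U ∈ B, indTopHausdorffDim n (frontier U) ≤ d - 1} := by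
  rw [indTopHausdorffDim, if_neg (not_isEmpty_of_nonempty X)]

theorem indTopHausdorffDim_of_isEmpty {X : Type*} [MetricSpace X] [h : IsEmpty X] (n : ℕ) :
    indTopHausdorffDim n X = -1 := by
  cases n with
  | zero => rw [indTopHausdorffDim, univ_eq_empty_iff.2 h, hausdorffDim_empty]
  | succ n => rw [indTopHausdorffDim, if_pos h]

theorem EReal.sub_one_lt_coe_of_lt {d : EReal} {r : ℝ} (h : d < ((r + 1 : ℝ) : EReal)) :
    d - 1 < (r : EReal) := by
  induction d with
  | bot => simp
  | top => simp at h
  | coe d =>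
    rw [EReal.coe_lt_coe_iff] at h
    rw [← EReal.coe_one, ← EReal.coe_sub, EReal.coe_lt_coe_iff]
    linarith

/-- Both dimensions recurse through frontiers, and in the base case a negative Hausdorff dimension
means emptiness. -/
theorem hasSmallInductiveDimensionLT_of_indTopHausdorffDim_lt (n : ℕ) :
    ∀ (X : Type u) [MetricSpace X], indTopHausdorffDim n X < ((n : ℝ) : EReal) →
      HasSmallInductiveDimensionLT X n := by
  induction n with
  | zero =>
    intro X _ h
    rw [hasSmallInductiveDimensionLT_zero_iff]
    by_contra hne
    rw [not_isEmpty_iff] at hne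
    rw [indTopHausdorffDim, hausdorffDim_of_nonempty univ_nonempty] at h
    exact absurd h (by simpa using EReal.coe_ennreal_nonneg _)
  | succ n ih =>
    intro X _ h
    rcases isEmpty_or_nonempty X with hX | hX
    · infer_instance
    rw [indTopHausdorffDim_succ_of_nonempty, sInf_lt_iff] at h
    obtain ⟨d, ⟨B, hB, hBd⟩, hd⟩ := h
    refine .succ n B hB fun U hU => ih _ ((hBd U hU).trans_lt ?_)
    exact EReal.sub_one_lt_coe_of_lt (by simpa using hd)

/-! ### Upper and lower bounds for generic fibers. -/

section GenericFibers

variable {K : Type*} [MetricSpace K] [CompactSpace K] {q : ℝ≥0}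

/-- If the `n`th dimension of a compact set is less than `q + n`, then all fibers over this set of
the generic `n`-tuple of continuous functions have zero `q`-dimensional content. -/
theorem eventually_residual_hausdorffContent_eq_zero (hq : 0 < q) (n : ℕ) :
    ∀ (X : Type u) [MetricSpace X] [CompactSpace X] (i : X → K), Isometry i →
      indTopHausdorffDim n X < ((q + n : ℝ) : EReal) →
      ∀ᶠ f in residual (Fin n → C(K, ℝ)), ∀ y,
        hausdorffContent q (commonFiber f y ∩ range i) = 0 := by
  induction n with
  | zero =>
    intro X _ _ i hi h
    refine .of_forall fun f y => ?_
    rcases isEmpty_or_nonempty X with hX | hX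
    · simp [range_eq_empty]
    rw [indTopHausdorffDim, hausdorffDim_of_nonempty univ_nonempty] at h
    refine hausdorffContent_eq_zero_of_dimH_lt ((dimH_mono inter_subset_right).trans_lt ?_)
    rw [← image_univ, hi.dimH_image, ← EReal.coe_ennreal_lt_coe_ennreal_iff,
      EReal.coe_nnreal_eq_coe_real]
    simpa using h
  | succ n ih =>
    intro X _ _ i hi h
    rcases isEmpty_or_nonempty X with hX | hX
    · exact .of_forall fun f y => by simp [range_eq_empty]
    rw [indTopHausdorffDim_succ_of_nonempty, sInf_lt_iff] at h
    obtain ⟨d, ⟨B, hB, hBd⟩, hd⟩ := h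
    have hd1 : d - 1 < ((q + n : ℝ) : EReal) :=
      EReal.sub_one_lt_coe_of_lt (by simpa [add_assoc] using hd)
    simp_rw [forall_hausdorffContent_eq_zero_iff]
    refine eventually_countable_forall.2 fun m => ?_
    have hrange : IsClosed (range i) := hi.isClosedEmbedding.isClosed_range
    refine residual_of_dense_open (isOpen_setOf_forall_hausdorffContent_lt hq hrange) ?_
    rw [dense_iff_inter_open]
    rintro O hO ⟨f₀, hf₀⟩
    obtain ⟨⟨a, f₀'⟩, rfl⟩ := (Homeomorph.finCons C(K, ℝ) n).surjective f₀
    obtain ⟨A, V, hA, hV, haA, hfV, hAV⟩ := isOpen_prod_iff.1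
      (hO.preimage (Homeomorph.finCons C(K, ℝ) n).continuous) a f₀' hf₀
    obtain ⟨ε, hε, hεA⟩ := Metric.isOpen_iff.1 hA a haA
    set η : ℝ≥0∞ := ((m : ℝ≥0∞) + 1)⁻¹ with hηdef
    have hη : 0 < η / 2 := ENNReal.half_pos (by simp [hηdef])
    -- a scale at which `a` varies little and sets of this diameter have small content
    obtain ⟨δ, hδ, hδη, hδa⟩ : ∃ δ > 0, ENNReal.ofReal δ ^ (q : ℝ) < η / 2 ∧
        ∀ x x', dist x x' ≤ δ → |a x - a x'| ≤ ε / 3 := by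
      obtain ⟨δ₁, hδ₁, h₁⟩ := Metric.uniformContinuous_iff.1
        (CompactSpace.uniformContinuous_of_continuous a.continuous) (ε / 3) (by positivity)
      have hc : Tendsto (fun x : ℝ => ENNReal.ofReal x ^ (q : ℝ)) (𝓝[>] 0) (𝓝 0) := by
        have : Continuous (fun x : ℝ => ENNReal.ofReal x ^ (q : ℝ)) :=
          ENNReal.continuous_rpow_const.comp ENNReal.continuous_ofReal
        have h0 := (this.tendsto 0).mono_left (nhdsWithin_le_nhds (s := Ioi 0))
        rwa [ENNReal.ofReal_zero, ENNReal.zero_rpow_of_pos (by exact_mod_cast hq)] at h0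
      obtain ⟨δ, h2, h3, h4⟩ := ((hc.eventually (gt_mem_nhds hη)).and
        (Ioo_mem_nhdsGT hδ₁)).exists
      exact ⟨δ, h3, h2, fun x x' hx => (h₁ (hx.trans_lt h4)).le⟩
    have hnhds (x : X) : ∃ U ∈ B, x ∈ U ∧ U ⊆ ball x (δ / 2) :=
      hB.exists_subset_of_mem_open (mem_ball_self (by positivity)) isOpen_ball
    choose U hUB hxU hUball using hnhds
    obtain ⟨t, -, ht⟩ := isCompact_univ.elim_nhds_subcover U
      fun x _ => (hB.isOpen (hUB x)).mem_nhds (hxU x)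
    have hUdist {x z w : X} (hz : z ∈ U x) (hw : w ∈ U x) : dist (i z) (i w) ≤ δ := by
      rw [hi.dist_eq]
      have h1 := mem_ball.1 (hUball x hz)
      have h2 := mem_ball'.1 (hUball x hw)
      linarith [dist_triangle z x w]
    have hgen : ∀ᶠ f in residual (Fin n → C(K, ℝ)), ∀ x ∈ t, ∀ y,
        hausdorffContent q (commonFiber f y ∩ i '' frontier (U x)) = 0 := by
      refine (eventually_all_finset t).2 fun x _ => ?_
      have : CompactSpace (frontier (U x)) :=
        isCompact_iff_compactSpace.1 isClosed_frontier.isCompact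
      have := ih (frontier (U x)) (i ∘ Subtype.val) (hi.comp isometry_subtype_coe)
        ((hBd _ (hUB x)).trans_lt hd1)
      simpa [range_comp] using this
    obtain ⟨f, hfV', hf⟩ := (dense_of_mem_residual hgen).inter_open_nonempty V hV ⟨_, hfV⟩
    have hF : IsClosed (⋃ x ∈ t, i '' frontier (U x)) :=
      t.finite_toSet.isClosed_biUnion fun x _ =>
        hi.isClosedEmbedding.isClosedMap _ isClosed_frontier
    obtain ⟨r, hr, hrF⟩ := exists_pos_forall_hausdorffContent_thickened_lt hq hF (f := f)
      (η := η / 2) fun y => by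
        refine lt_of_le_of_lt ?_ hη
        rw [inter_iUnion₂]
        exact ((measure_biUnion_null_iff t.countable_toSet).2 fun x hx => hf x hx y).le
    set N := thickening r (⋃ x ∈ t, i '' frontier (U x)) with hN
    have hW : IsClosed (i ⁻¹' Nᶜ) := isOpen_thickening.isClosed_compl.preimage hi.continuous
    obtain ⟨b, hb, hbU⟩ := exists_perturbation_of_clopen_cover (W := ↥(i ⁻¹' Nᶜ)) (ι := t)
      (e := i ∘ Subtype.val) (hi.isClosedEmbedding.comp hW.isClosedEmbedding_subtypeVal) a
      (ε := ε / 3) (by positivity) (fun x => Subtype.val ⁻¹' U x)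
      (fun x => by
        refine ⟨?_, (hB.isOpen (hUB x)).preimage continuous_subtype_val⟩
        -- The frontier of `U x` is removed together with `N`, so the trace of `U x` is closed.
        have : (Subtype.val ⁻¹' U x : Set ↥(i ⁻¹' Nᶜ)) = Subtype.val ⁻¹' closure (U x) := by
          refine (preimage_mono subset_closure).antisymm fun w hw => ?_
          by_contra hwU
          refine w.2 (self_subset_thickening hr _ (mem_iUnion₂.2 ⟨x, x.2, w, ?_, rfl⟩))
          rw [(hB.isOpen (hUB x)).frontier_eq]
          exact ⟨hw, hwU⟩
        rw [this]
        exact isClosed_closure.preimage continuous_subtype_val)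
      (fun w => by
        obtain ⟨x, hx, hwx⟩ := mem_iUnion₂.1 (ht (mem_univ w.1))
        exact ⟨⟨x, hx⟩, hwx⟩)
      (fun x z hz w hw => hδa _ _ (hUdist hz hw))
    refine ⟨Homeomorph.finCons C(K, ℝ) n (b, f), hAV ⟨hεA ?_, hfV'⟩, fun y => ?_⟩
    · rw [mem_ball, ContinuousMap.dist_lt_iff hε]
      intro x
      rw [Real.dist_eq]
      linarith [hb x]
    · rw [Homeomorph.finCons_apply, commonFiber_cons]
      -- Inside `N` the coordinates `f` make the content small; outside, `b` confines the fiber to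
      -- one set of diameter at most `δ`. Each part costs less than `η / 2`.
      have hsub : {x | b x = y 0} ∩ commonFiber f (Fin.tail y) ∩ range i ⊆
          {x ∈ N | ∀ j, |f j x - Fin.tail y j| < r} ∪ ({x | b x = y 0} ∩ (range i \ N)) := by
        rintro x ⟨⟨hx0, hxf⟩, hxi⟩
        by_cases hxN : x ∈ N
        · exact .inl ⟨hxN, fun j => by rw [hxf j]; simpa using hr⟩
        · exact .inr ⟨hx0, hxi, hxN⟩
      have hdiam : ediam ({x | b x = y 0} ∩ (range i \ N)) ≤ ENNReal.ofReal δ := by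
        refine ediam_le ?_
        rintro _ ⟨hx0, ⟨x, rfl⟩, hxN⟩ _ ⟨hx0', ⟨x', rfl⟩, hxN'⟩
        obtain ⟨j, hj, hj'⟩ := hbU ⟨x, hxN⟩ ⟨x', hxN'⟩
          ((show b (i x) = y 0 from hx0).trans (show b (i x') = y 0 from hx0').symm)
        rw [edist_dist]
        exact ENNReal.ofReal_le_ofReal (hUdist hj hj')
      calc _ ≤ _ := measure_mono hsub
        _ ≤ _ := measure_union_le _ _
        _ < η / 2 + η / 2 := ENNReal.add_lt_add (hrF _) ?_
        _ = η := ENNReal.add_halves η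
      refine (hausdorffContent_le_ediam _ _).trans_lt (lt_of_le_of_lt ?_ hδη)
      gcongr

/-- Every point has arbitrarily small neighbourhoods whose frontier is contained in a level set of
a function from a prescribed dense set that is close to a given function. -/
theorem exists_isOpen_frontier_subset_levelSet {X : Type*} [MetricSpace X] {i : X → K}
    (hi : Isometry i) {S : Set C(K, ℝ)} (hS : Dense S) (a : C(K, ℝ)) {ε : ℝ} (hε : 0 < ε) {x : X}
    {V : Set X} (hV : V ∈ 𝓝 x) :
    ∃ b ∈ S, dist b a < ε ∧ ∃ U : Set X, IsOpen U ∧ x ∈ U ∧ U ⊆ V ∧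
      ∃ c : ℝ, ∀ z ∈ frontier U, b (i z) = c := by
  have hcont : ∀ᶠ z in 𝓝 x, |a (i z) - a (i x)| < ε / 8 :=
    ((a.continuous.comp hi.continuous).tendsto x).eventually
      (Metric.ball_mem_nhds _ (by positivity : 0 < ε / 8))
  obtain ⟨δ, hδ, hδV⟩ := Metric.nhds_basis_closedBall.mem_iff.1 (inter_mem hV hcont)
  -- The added cone makes every `b` within `ε / 16` of `h` lie below `a (i x) + ε / 4` at `i x` and
  -- above it at distance `δ`. The frontier of the sublevel set in the ball thus misses the sphere
  -- and lies in a level set.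
  let h : C(K, ℝ) := ⟨fun z => a z + ε / 2 * min 1 (dist z (i x) / δ), by fun_prop⟩
  obtain ⟨b, hbh, hbS⟩ := hS.inter_open_nonempty (ball h (ε / 16)) isOpen_ball
    ⟨h, mem_ball_self (by positivity)⟩
  have hbz (z : K) : |b z - (a z + ε / 2 * min 1 (dist z (i x) / δ))| < ε / 16 :=
    (ContinuousMap.dist_apply_le_dist z).trans_lt hbh
  have hopen : IsOpen {z : X | dist z x < δ ∧ b (i z) < a (i x) + ε / 4} :=
    isOpen_ball.inter (isOpen_lt (b.continuous.comp hi.continuous) continuous_const)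
  refine ⟨b, hbS, ?_, {z | dist z x < δ ∧ b (i z) < a (i x) + ε / 4}, ?_, ?_, ?_,
    a (i x) + ε / 4, ?_⟩
  · rw [ContinuousMap.dist_lt_iff hε]
    intro z
    have h1 := abs_lt.1 (hbz z)
    have h2 : min 1 (dist z (i x) / δ) ≤ 1 := min_le_left _ _
    have h3 : 0 ≤ min 1 (dist z (i x) / δ) := by positivity
    rw [Real.dist_eq, abs_lt]
    constructor <;> nlinarith
  · exact hopen
  · have h1 := abs_lt.1 (hbz (i x))
    simp only [dist_self, zero_div, min_eq_right zero_le_one, mul_zero, add_zero] at h1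
    exact ⟨by simpa using hδ, by linarith⟩
  · exact fun z hz => (hδV (mem_closedBall.2 hz.1.le)).1
  · intro z hz
    have hcl : dist z x ≤ δ ∧ b (i z) ≤ a (i x) + ε / 4 := by
      have hclosed : IsClosed {z : X | dist z x ≤ δ ∧ b (i z) ≤ a (i x) + ε / 4} :=
        isClosed_closedBall.inter
          (isClosed_le (b.continuous.comp hi.continuous) continuous_const)
      exact closure_minimal
        (ofPred_subset_ofPred.2 fun w hw => ⟨hw.1.le, hw.2.le⟩) hclosed hz.1
    refine hcl.2.antisymm (not_lt.1 fun hlt => ?_)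
    rw [hopen.frontier_eq] at hz
    have hd : dist z x = δ := hcl.1.antisymm (not_lt.1 fun h' => hz.2 ⟨h', hlt⟩)
    have h1 := abs_lt.1 (hbz (i z))
    rw [hi.dist_eq, hd, div_self hδ.ne', min_self] at h1
    have h2 := abs_lt.1 (show |a (i z) - a (i x)| < ε / 8 from
      (hδV (mem_closedBall.2 hcl.1)).2)
    linarith

/-- If residually many `n`-tuples in a non-empty open set have all their fibers over a compact set
of zero `q`-dimensional content, then the `n`th dimension of this set is at most `q + n`. -/
theorem indTopHausdorffDim_le_of_eventually_residual (hq : 0 < q) (n : ℕ) :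
    ∀ (X : Type u) [MetricSpace X] [CompactSpace X] (i : X → K), Isometry i →
      ∀ O : Set (Fin n → C(K, ℝ)), IsOpen O → O.Nonempty →
      (∀ᶠ f in residual (Fin n → C(K, ℝ)), f ∈ O → ∀ y,
        hausdorffContent q (commonFiber f y ∩ range i) = 0) →
      indTopHausdorffDim n X ≤ ((q + n : ℝ) : EReal) := by
  induction n with
  | zero =>
    intro X _ _ i hi O hO hne h
    rcases isEmpty_or_nonempty X with hX | hX
    · rw [indTopHausdorffDim_of_isEmpty, ← EReal.coe_one, ← EReal.coe_neg, EReal.coe_le_coe_iff]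
      push_cast
      linarith [q.coe_nonneg]
    obtain ⟨f, hfO, hf⟩ := (dense_of_mem_residual h).inter_open_nonempty O hO hne
    have h0 := hf hfO 0
    have huniv : commonFiber f 0 = univ := eq_univ_of_forall fun x j => j.elim0
    rw [huniv, univ_inter] at h0
    have hdim := dimH_le_of_hausdorffContent_eq_zero hq h0
    rw [← image_univ, hi.dimH_image, ← EReal.coe_ennreal_le_coe_ennreal_iff,
      EReal.coe_nnreal_eq_coe_real] at hdim
    rw [indTopHausdorffDim, hausdorffDim_of_nonempty univ_nonempty]
    simpa using hdim
  | succ n ih =>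
    intro X _ _ i hi O hO hne h
    rcases isEmpty_or_nonempty X with hX | hX
    · rw [indTopHausdorffDim_of_isEmpty, ← EReal.coe_one, ← EReal.coe_neg, EReal.coe_le_coe_iff]
      push_cast
      linarith [q.coe_nonneg, (n.cast_nonneg : (0 : ℝ) ≤ n)]
    rw [indTopHausdorffDim_succ_of_nonempty]
    refine sInf_le ⟨{U | IsOpen U ∧ indTopHausdorffDim n (frontier U) ≤ ((q + n : ℝ) : EReal)},
      isTopologicalBasis_of_isOpen_of_nhds (fun U hU => hU.1) fun x V hxV hV => ?_,
      fun U hU => hU.2.trans_eq ?_⟩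
    swap
    · rw [← EReal.coe_one, ← EReal.coe_sub, EReal.coe_eq_coe_iff]
      push_cast
      ring
    let e := Homeomorph.finCons C(K, ℝ) n
    obtain ⟨f₀, hf₀⟩ := hne
    obtain ⟨⟨a, f₀'⟩, rfl⟩ := e.surjective f₀
    have hOa : IsOpen {b | e (b, f₀') ∈ O} := hO.preimage (by fun_prop)
    obtain ⟨ε, hε, hεO⟩ := Metric.isOpen_iff.1 hOa a hf₀
    rw [← e.residual_map_eq, eventually_map] at h
    have hdense := dense_of_mem_residual (eventually_residual_curry h)
    obtain ⟨b, hb, hba, U, hU, hxU, hUV, c, hc⟩ :=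
      exists_isOpen_frontier_subset_levelSet hi hdense a hε (hV.mem_nhds hxV)
    have : CompactSpace (frontier U) := isCompact_iff_compactSpace.1 isClosed_frontier.isCompact
    refine ⟨U, ⟨hU, ih (frontier U) (i ∘ Subtype.val) (hi.comp isometry_subtype_coe)
      {f | e (b, f) ∈ O} (hO.preimage (by fun_prop)) ⟨f₀', hεO hba⟩ ?_⟩, hxU, hUV⟩
    change ∀ᶠ f in residual (Fin n → C(K, ℝ)), _ at hb
    filter_upwards [hb] with f hf hfO y
    -- Since `b` equals `c` on the frontier, a fiber of `f` there lies in a fiber of the full tuple.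
    refine measure_mono_null ?_ (hf hfO (Fin.cons c y))
    rintro _ ⟨hz, ⟨z, rfl⟩⟩
    refine ⟨?_, z, rfl⟩
    rw [Homeomorph.finCons_apply, commonFiber_cons]
    exact ⟨hc z z.2, by simpa using hz⟩

/-- The coordinates of a continuous map to a Euclidean space. -/
noncomputable def euclideanCoordHomeomorph (K : Type*) [TopologicalSpace K] [LocallyCompactSpace K]
    (n : ℕ) : C(K, EuclideanSpace ℝ (Fin n)) ≃ₜ (Fin n → C(K, ℝ)) where
  toFun f j := ⟨fun x => f x j, by fun_prop⟩
  invFun g := ⟨fun x => WithLp.toLp 2 fun j => g j x, by fun_prop⟩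
  left_inv f := by ext; simp
  right_inv g := by ext; simp
  continuous_toFun := continuous_pi fun j => ContinuousMap.continuous_postcomp
    (⟨fun v => v j, by fun_prop⟩ : C(EuclideanSpace ℝ (Fin n), ℝ))
  continuous_invFun := by
    refine ContinuousMap.continuous_of_continuous_uncurry _ ?_
    refine (PiLp.continuous_toLp 2 _).comp (continuous_pi fun j => ?_)
    exact continuous_eval.comp
      (((continuous_apply j).comp continuous_fst).prodMk continuous_snd)

theorem commonFiber_euclideanCoordHomeomorph {n : ℕ} (f : C(K, EuclideanSpace ℝ (Fin n)))
    (y : Fin n → ℝ) :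
    commonFiber (euclideanCoordHomeomorph K n f) y = f ⁻¹' {WithLp.toLp 2 y} := by
  ext x
  rw [mem_commonFiber, mem_preimage, mem_singleton_iff, PiLp.ext_iff]
  rfl

theorem eventually_residual_dimH_fiber_le (hq : 0 < q) {n : ℕ}
    (h : indTopHausdorffDim n K < ((q + n : ℝ) : EReal)) :
    ∀ᶠ f : C(K, EuclideanSpace ℝ (Fin n)) in residual _, ∀ y, dimH (f ⁻¹' {y}) ≤ q := by
  have := eventually_residual_hausdorffContent_eq_zero hq n K id isometry_id h
  rw [← (euclideanCoordHomeomorph K n).residual_map_eq, eventually_map] at this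
  filter_upwards [this] with f hf y
  have := hf y.ofLp
  rw [commonFiber_euclideanCoordHomeomorph, range_id, inter_univ] at this
  exact dimH_le_of_hausdorffContent_eq_zero hq this

theorem eventually_residual_exists_le_dimH_fiber (hq : 0 < q) {n : ℕ}
    (h : ((q + n : ℝ) : EReal) < indTopHausdorffDim n K) :
    ∀ᶠ f : C(K, EuclideanSpace ℝ (Fin n)) in residual _, ∃ y, q ≤ dimH (f ⁻¹' {y}) := by
  have := eventually_residual_not_of_forall_isOpen (X := Fin n → C(K, ℝ))
    (p := fun m f => ∀ y, hausdorffContent q (commonFiber f y ∩ range (id : K → K))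
      < ((m : ℝ≥0∞) + 1)⁻¹)
    (fun m => isOpen_setOf_forall_hausdorffContent_lt hq (by simp)) fun O hO hne hres => by
      simp_rw [← forall_hausdorffContent_eq_zero_iff] at hres
      exact (indTopHausdorffDim_le_of_eventually_residual hq n K id isometry_id O hO hne hres).not_gt
        h
  simp_rw [← forall_hausdorffContent_eq_zero_iff] at this
  rw [← (euclideanCoordHomeomorph K n).residual_map_eq, eventually_map] at this
  filter_upwards [this] with f hf
  push Not at hf
  obtain ⟨y, hy⟩ := hf
  rw [commonFiber_euclideanCoordHomeomorph, range_id, inter_univ] at hy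
  exact ⟨WithLp.toLp 2 y, not_lt.1 fun hlt => hy (hausdorffContent_eq_zero_of_dimH_lt hlt)⟩

end GenericFibers

/-! ### Passage to the supremum through countably many rational exponents. -/

theorem EReal.exists_nnrat_btwn {a b : EReal} (ha : 0 ≤ a) (h : a < b) :
    ∃ r : ℚ≥0, 0 < r ∧ a < (((r : ℝ≥0) : ℝ) : EReal) ∧ (((r : ℝ≥0) : ℝ) : EReal) < b := by
  obtain ⟨r, hr, hr'⟩ := EReal.lt_iff_exists_rat_btwn.1 h
  have h0 : 0 < r := by
    have := ha.trans_lt hr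
    rw [← EReal.coe_zero, EReal.coe_lt_coe_iff] at this
    exact_mod_cast this
  lift r to ℚ≥0 using h0.le
  exact ⟨r, by exact_mod_cast h0, by exact_mod_cast hr, by exact_mod_cast hr'⟩

theorem corollary6p10 {K : Type*} [MetricSpace K] [CompactSpace K] (n : ℕ) (hn : 0 < n)
    (hK : (n : WithBot ℕ∞) ≤ smallInductiveDimension K) :
    ∀ᶠ f : C(K, EuclideanSpace ℝ (Fin n)) in residual C(K, EuclideanSpace ℝ (Fin n)),
      (⨆ y : EuclideanSpace ℝ (Fin n), hausdorffDim (f ⁻¹' {y}))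
        = indTopHausdorffDim n K - (n : EReal) := by
  have hnlt : ¬ HasSmallInductiveDimensionLT K n := by
    rwa [← smallInductiveDimension_lt_iff, not_lt]
  have hne : Nonempty K := by
    by_contra h
    rw [not_nonempty_iff] at h
    exact hnlt inferInstance
  have hD : (n : EReal) ≤ indTopHausdorffDim n K := by
    by_contra! h
    exact hnlt (hasSmallInductiveDimensionLT_of_indTopHausdorffDim_lt n K (by exact_mod_cast h))
  set D := indTopHausdorffDim n K with hDdef
  -- Here $\dim_t K\ge n$ enters: the target is non-negative, so positive rational exponents suffice
  -- and empty fibers, of dimension `-1`, do no harm.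
  have hsub0 : 0 ≤ D - n := by
    rw [EReal.sub_nonneg (.inr (EReal.natCast_ne_top n)) (.inr (EReal.natCast_ne_bot n))]
    exact hD
  have hadd (r : ℚ≥0) : ((((r : ℝ≥0) : ℝ) + n : ℝ) : EReal) = (((r : ℝ≥0) : ℝ) : EReal) + n := by
    push_cast; rfl
  have hupper : ∀ᶠ f : C(K, EuclideanSpace ℝ (Fin n)) in residual _, ∀ r : ℚ≥0, 0 < r →
      D - n < (((r : ℝ≥0) : ℝ) : EReal) → ∀ y, dimH (f ⁻¹' {y}) ≤ (r : ℝ≥0) := by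
    refine eventually_countable_forall.2 fun r => ?_
    by_cases hr : 0 < r ∧ D - n < (((r : ℝ≥0) : ℝ) : EReal)
    · filter_upwards [eventually_residual_dimH_fiber_le (K := K) (q := r) (n := n)
        (by exact_mod_cast hr.1) (by
          rw [hadd]
          exact (EReal.sub_lt_iff (.inl (EReal.natCast_ne_bot n))
            (.inl (EReal.natCast_ne_top n))).1 hr.2)] with f hf _ _ using hf
    · exact .of_forall fun f h1 h2 => (hr ⟨h1, h2⟩).elim
  have hlower : ∀ᶠ f : C(K, EuclideanSpace ℝ (Fin n)) in residual _, ∀ r : ℚ≥0, 0 < r →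
      (((r : ℝ≥0) : ℝ) : EReal) < D - n → ∃ y, (r : ℝ≥0) ≤ dimH (f ⁻¹' {y}) := by
    refine eventually_countable_forall.2 fun r => ?_
    by_cases hr : 0 < r ∧ (((r : ℝ≥0) : ℝ) : EReal) < D - n
    · filter_upwards [eventually_residual_exists_le_dimH_fiber (K := K) (q := r) (n := n)
        (by exact_mod_cast hr.1) (by
          rw [hadd]
          exact (EReal.lt_sub_iff_add_lt (.inl (EReal.natCast_ne_bot n))
            (.inl (EReal.natCast_ne_top n))).1 hr.2)] with f hf _ _ using hf
    · exact .of_forall fun f h1 h2 => (hr ⟨h1, h2⟩).elim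
  filter_upwards [hupper, hlower] with f hfu hfl
  apply le_antisymm
  · refine iSup_le fun y => ?_
    rcases (f ⁻¹' {y}).eq_empty_or_nonempty with he | he
    · rw [he, hausdorffDim_empty]
      exact le_trans (by simp) hsub0
    rw [hausdorffDim_of_nonempty he]
    refine le_of_forall_gt fun c hc => ?_
    obtain ⟨r, hr0, hr, hrc⟩ := EReal.exists_nnrat_btwn hsub0 hc
    refine lt_of_le_of_lt ?_ hrc
    rw [← EReal.coe_nnreal_eq_coe_real, EReal.coe_ennreal_le_coe_ennreal_iff]
    exact hfu r hr0 hr y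
  · have hnonneg : 0 ≤ ⨆ y : EuclideanSpace ℝ (Fin n), hausdorffDim (f ⁻¹' {y}) := by
      obtain ⟨x⟩ := hne
      refine le_iSup_of_le (f x) ?_
      rw [hausdorffDim_of_nonempty (s := f ⁻¹' {f x}) ⟨x, rfl⟩]
      exact EReal.coe_ennreal_nonneg _
    refine le_of_not_gt fun hlt => ?_
    obtain ⟨r, hr0, hr, hrD⟩ := EReal.exists_nnrat_btwn hnonneg hlt
    obtain ⟨y, hy⟩ := hfl r hr0 hrD
    -- Positivity of `r` rules out an empty fiber, for which `dimH` is `0` while `hausdorffDim` is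
    -- `-1`.
    have hrpos : (0 : ℝ≥0∞) < (r : ℝ≥0) := by exact_mod_cast hr0
    have hyne : (f ⁻¹' {y}).Nonempty := by
      rw [nonempty_iff_ne_empty]
      intro he
      rw [he, dimH_empty] at hy
      exact hy.not_gt hrpos
    refine hr.not_ge (le_iSup_of_le y ?_)
    rw [hausdorffDim_of_nonempty hyne, ← EReal.coe_nnreal_eq_coe_real,
      EReal.coe_ennreal_le_coe_ennreal_iff]
    exact hy
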